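/- An ai-semiring is an algebra $(S,+,\cdot)$ with two binary operations such that $(S,+)$ is a commutative idempotent semigroup, $(S,\cdot)$ is a semigroup, and $\cdot$ distributes over $+$ from both sides. For an ai-semiring $S$, let $S^0=S\cup\{0\}$ be the ai-semiring obtained by adjoining a new element $0$ with $a+0=0+a=a$ and $a0=0a=0$ for all $a\in S\cup\{0\}$. Let $S_7=\{\infty,a,1\}$ be the ai-semiring in which $x+x=x$ for all $x$, $x+y=\infty$ for $x\neq y$, $1$ is a multiplicative identity, $\infty$ is multiplicatively absorbing, and $a\cdot a=\infty$. Let $S_{(4,435)}=\{1,2,3,4\}$ be the ai-semiring whose addition is the join operation of the order with greatest element $1$, least element $2$ and incomparable middle elements $3,4$, and whose multiplication has the Cayley table (rows and columns indexed by $1,2,3,4$) $$\begin{array}{cccc}1&2&1&1\\2&2&2&2\\1&2&1&3\\1&2&3&4\end{array}$$ Then $S_{(4,435)}$ is isomorphic to $S_7^0$, and $S_{(4,435)}$ is nonfinitely based: there is no finite set $\Sigma$ of ai-semiring identities satisfied by $S_{(4,435)}$ such that every identity satisfied by $S_{(4,435)}$ holds in every ai-semiring satisfying $\Sigma$. -/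

import Mathlib

/-- An additively idempotent semiring (ai-semiring): `(S, +)` is a commutative idempotent semigroup,
`(S, *)` is a semigroup, and `*` distributes over `+` from both sides.
No neutral elements are required. -/
class AiSemiring (S : Type*) extends AddCommSemigroup S, Semigroup S, Distrib S where
  add_idem : ∀ a : S, a + a = a

/-- Ai-semiring terms over the countable set `x 0, x 1, x 2, …` of variables. -/
inductive AiTerm : Type where
  | var : ℕ → AiTerm
  | add : AiTerm → AiTerm → AiTerm
  | mul : AiTerm → AiTerm → AiTerm

/-- The value of a term under an assignment of elements to the variables. -/
def AiTerm.eval {S : Type*} [AiSemiring S] (f : ℕ → S) : AiTerm → S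
  | .var n => f n
  | .add u v => u.eval f + v.eval f
  | .mul u v => u.eval f * v.eval f

/-- An ai-semiring identity `u ≈ v`, given as the pair `(u, v)`. -/
abbrev AiIdentity : Type := AiTerm × AiTerm

/-- The ai-semiring `S` satisfies the identity `u ≈ v`. -/
def AiIdentity.HoldsIn (e : AiIdentity) (S : Type*) [AiSemiring S] : Prop :=
  ∀ f : ℕ → S, e.1.eval f = e.2.eval f

/-- `B` is an equational basis of `S` (among ai-semirings): `S` satisfies the identities in `B`, and
every identity of `S` is a consequence of `B`, that is, it holds in every ai-semiring in which all
identities of `B` hold. Since terms have countably many variables, letting the models range over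
`Type` gives the usual notion of consequence. -/
def IsEquationalBasis (B : Set AiIdentity) (S : Type*) [AiSemiring S] : Prop :=
  (∀ e ∈ B, e.HoldsIn S) ∧
    ∀ e : AiIdentity, e.HoldsIn S →
      ∀ (A : Type) [AiSemiring A], (∀ b ∈ B, b.HoldsIn A) → e.HoldsIn A

/-- An ai-semiring is finitely based if it has a finite equational basis. -/
def IsFinitelyBased (S : Type*) [AiSemiring S] : Prop :=
  ∃ B : Set AiIdentity, B.Finite ∧ IsEquationalBasis B S

/-- `S⁰`: Mathlib's `WithZero S` adjoins an element `0` with `a + 0 = 0 + a = a` and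
`a * 0 = 0 * a = 0`. -/
instance WithZero.instAiSemiring {S : Type*} [AiSemiring S] : AiSemiring (WithZero S) where
  add_assoc := add_assoc
  add_comm := add_comm
  mul_assoc := mul_assoc
  left_distrib := mul_add
  right_distrib := add_mul
  add_idem := by
    intro a
    induction a using WithZero.recZeroCoe with
    | zero => exact add_zero 0
    | coe a => rw [← WithZero.coe_add, AiSemiring.add_idem]

/-- The carrier of the ai-semiring `S₇ = {∞, a, 1}`. -/
inductive S7 : Type where
  | infty
  | a
  | one
deriving DecidableEq

namespace S7

/-- Addition of `S₇`: `x + x = x`, and `x + y = ∞` for `x ≠ y`. -/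
def add : S7 → S7 → S7
  | a, a => a
  | one, one => one
  | _, _ => infty

/-- Multiplication of `S₇`: `1` is the identity, `∞` is absorbing, and `a * a = ∞`. -/
def mul : S7 → S7 → S7
  | one, y => y
  | x, one => x
  | _, _ => infty

instance : AiSemiring S7 where
  add := add
  mul := mul
  add_assoc := by rintro (_ | _ | _) (_ | _ | _) (_ | _ | _) <;> rfl
  add_comm := by rintro (_ | _ | _) (_ | _ | _) <;> rfl
  mul_assoc := by rintro (_ | _ | _) (_ | _ | _) (_ | _ | _) <;> rfl
  left_distrib := by rintro (_ | _ | _) (_ | _ | _) (_ | _ | _) <;> rfl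
  right_distrib := by rintro (_ | _ | _) (_ | _ | _) (_ | _ | _) <;> rfl
  add_idem := by rintro (_ | _ | _) <;> rfl

end S7

/-- The carrier `{1, 2, 3, 4}` of the ai-semiring `S_(4,435)`. -/
inductive S4435 : Type where
  | e1
  | e2
  | e3
  | e4
deriving DecidableEq

namespace S4435

/-- Addition of `S_(4,435)`: the join for the order with top `1`, bottom `2` and the two
incomparable middle elements `3` and `4`. -/
def add : S4435 → S4435 → S4435
  | e2, y => y
  | x, e2 => x
  | e3, e3 => e3
  | e4, e4 => e4
  | _, _ => e1

/-- Multiplication of `S_(4,435)`: the Cayley table, row by row, is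
`1 2 1 1`, `2 2 2 2`, `1 2 1 3`, `1 2 3 4`. -/
def mul : S4435 → S4435 → S4435
  | e1, e1 => e1
  | e1, e2 => e2
  | e1, e3 => e1
  | e1, e4 => e1
  | e2, _ => e2
  | e3, e1 => e1
  | e3, e2 => e2
  | e3, e3 => e1
  | e3, e4 => e3
  | e4, e1 => e1
  | e4, e2 => e2
  | e4, e3 => e3
  | e4, e4 => e4

instance : AiSemiring S4435 where
  add := add
  mul := mul
  add_assoc := by rintro (_ | _ | _ | _) (_ | _ | _ | _) (_ | _ | _ | _) <;> rfl
  add_comm := by rintro (_ | _ | _ | _) (_ | _ | _ | _) <;> rfl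
  mul_assoc := by rintro (_ | _ | _ | _) (_ | _ | _ | _) (_ | _ | _ | _) <;> rfl
  left_distrib := by rintro (_ | _ | _ | _) (_ | _ | _ | _) (_ | _ | _ | _) <;> rfl
  right_distrib := by rintro (_ | _ | _ | _) (_ | _ | _ | _) (_ | _ | _ | _) <;> rfl
  add_idem := by rintro (_ | _ | _ | _) <;> rfl

end S4435

/-!
The isomorphism is `1 ↦ ∞`, `2 ↦ 0`, `3 ↦ a`, `4 ↦ 1`.

For the absence of a finite basis, write `a ≤ b` for `a + b = b`. In a commutative ai-semiring the
value of a term is the least upper bound of the values of its words (`AiTerm.word_le_eval`,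
`AiTerm.eval_le`), so an identity `u ≈ v` amounts to the inequalities `w ≤ u` for the words `w` of
`v`, and `w ≤ v` for the words `w` of `u`.

Sums of two-letter words `x y` are graphs, and an assignment of `3` and `4` to the letters that
gives all these words the value `3` is a proper 2-colouring. An odd cycle has none, so the sum of its
edges has the value `1` unless some letter is `2` or all letters are `4`. Hence it dominates the
product of all letters in `S_(4,435)` (`cycleIdentity_holdsIn`). If, on the other hand, `u` is a sum
of one-letter words and of the edges of a 2-colourable graph on other letters, then `w ≤ u` holds in
`S_(4,435)` only if `w` is a word of `u`, up to commuting its letters (`S4435.mem_words_of_le`):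
assigning `2` to the letters outside `w` deletes all words of `u` that are not
supported in `w`, and the two colourings of the rest bound the length of `w`.

The semiring `CycleModel n` consists of the nonempty sets of vertices of the `n`-cycle, an element
`edge`, which is the product of any two sets of vertices that are completely joined, and `top`.
If `u` has fewer than `n` letters and its value in `CycleModel n` is not `top`, the letters of its
two-letter words are sent to vertices of the cycle missing at least one vertex, and a cycle without
a vertex is 2-colourable. By the previous remark `CycleModel n` satisfies all identities of
`S_(4,435)` in fewer than `n` letters (`CycleModel.holdsIn`), but for `n ≥ 3` it fails the identity of
the `n`-cycle. So no set of identities of `S_(4,435)` in boundedly many letters is a basis.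
-/

/-! ### Words of a term -/

section Order

variable {S : Type*} [AiSemiring S]

theorem AiSemiring.le_trans {a b c : S} (hab : a + b = b) (hbc : b + c = c) : a + c = c := by
  rw [← hbc, ← add_assoc, hab]

theorem AiSemiring.le_add_left (a b : S) : a + (a + b) = a + b := by
  rw [← add_assoc, AiSemiring.add_idem]

theorem AiSemiring.le_add_right (a b : S) : b + (a + b) = a + b := by
  rw [add_comm a b, AiSemiring.le_add_left]

theorem AiSemiring.mul_le_mul {a b c d : S} (hab : a + b = b) (hcd : c + d = d) :
    a * c + b * d = b * d := by
  have h₁ : a * c + a * d = a * d := by rw [← mul_add, hcd]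
  have h₂ : a * d + b * d = b * d := by rw [← add_mul, hab]
  exact AiSemiring.le_trans h₁ h₂

end Order

/-- The words of a term, as lists of letters: the monomials obtained by expanding it with the
distributive laws. -/
def AiTerm.words : AiTerm → Set (List ℕ)
  | .var n => {[n]}
  | .add u v => u.words ∪ v.words
  | .mul u v => Set.image2 (· ++ ·) u.words v.words

/-- The product of the values of the letters of a nonempty word. The empty word, which is not a word
of any term, gets a junk value. -/
def wordEval {S : Type*} [AiSemiring S] (f : ℕ → S) : List ℕ → S
  | [] => f 0
  | [x] => f x
  | x :: y :: l => f x * wordEval f (y :: l)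

section Words

variable {S : Type*} [AiSemiring S]

theorem AiTerm.ne_nil_of_mem_words {t : AiTerm} {w : List ℕ} (hw : w ∈ t.words) : w ≠ [] := by
  induction t generalizing w with
  | var n => rintro rfl; simp [AiTerm.words] at hw
  | add u v hu hv => exact hw.elim hu hv
  | mul u v hu hv =>
    obtain ⟨w₁, h₁, w₂, -, rfl⟩ := hw
    simp [hu h₁]

theorem wordEval_cons (f : ℕ → S) (x : ℕ) {l : List ℕ} (hl : l ≠ []) :
    wordEval f (x :: l) = f x * wordEval f l := by
  cases l with
  | nil => exact absurd rfl hl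
  | cons y l => rfl

theorem wordEval_append (f : ℕ → S) {l₁ l₂ : List ℕ} (h₁ : l₁ ≠ []) (h₂ : l₂ ≠ []) :
    wordEval f (l₁ ++ l₂) = wordEval f l₁ * wordEval f l₂ := by
  induction l₁ with
  | nil => exact absurd rfl h₁
  | cons x l ih =>
    by_cases hl : l = []
    · subst hl
      exact wordEval_cons f x h₂
    · rw [List.cons_append, wordEval_cons f x (by simp [hl]), ih hl, wordEval_cons f x hl,
        mul_assoc]

theorem AiTerm.word_le_eval (f : ℕ → S) {t : AiTerm} {w : List ℕ} (hw : w ∈ t.words) :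
    wordEval f w + t.eval f = t.eval f := by
  induction t generalizing w with
  | var n =>
    obtain rfl : w = [n] := hw
    exact AiSemiring.add_idem _
  | add u v hu hv =>
    rcases hw with hw | hw
    · exact AiSemiring.le_trans (hu hw) (AiSemiring.le_add_left _ _)
    · exact AiSemiring.le_trans (hv hw) (AiSemiring.le_add_right _ _)
  | mul u v hu hv =>
    obtain ⟨w₁, h₁, w₂, h₂, rfl⟩ := hw
    rw [wordEval_append f (ne_nil_of_mem_words h₁) (ne_nil_of_mem_words h₂)]
    exact AiSemiring.mul_le_mul (hu h₁) (hv h₂)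

theorem AiTerm.mul_eval_le (hc : ∀ a b : S, a * b = b * a) (f : ℕ → S) {t : AiTerm} {b c : S}
    (h : ∀ w ∈ t.words, c * wordEval f w + b = b) : c * t.eval f + b = b := by
  induction t generalizing c with
  | var n => exact h [n] rfl
  | add u v hu hv =>
    change c * (u.eval f + v.eval f) + b = b
    rw [mul_add, add_assoc, hv fun w hw => h w (Or.inr hw), hu fun w hw => h w (Or.inl hw)]
  | mul u v hu hv =>
    change c * (u.eval f * v.eval f) + b = b
    rw [← mul_assoc]
    refine hv fun w₂ h₂ => ?_
    rw [mul_assoc, hc _ (wordEval f w₂), ← mul_assoc]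
    refine hu fun w₁ h₁ => ?_
    rw [mul_assoc, hc (wordEval f w₂),
      ← wordEval_append f (ne_nil_of_mem_words h₁) (ne_nil_of_mem_words h₂)]
    exact h _ ⟨w₁, h₁, w₂, h₂, rfl⟩

theorem AiTerm.eval_le (hc : ∀ a b : S, a * b = b * a) (f : ℕ → S) {t : AiTerm} {b : S}
    (h : ∀ w ∈ t.words, wordEval f w + b = b) : t.eval f + b = b := by
  induction t with
  | var n => exact h [n] rfl
  | add u v hu hv =>
    change (u.eval f + v.eval f) + b = b
    rw [add_assoc, hv fun w hw => h w (Or.inr hw), hu fun w hw => h w (Or.inl hw)]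
  | mul u v hu hv =>
    change u.eval f * v.eval f + b = b
    refine mul_eval_le hc f fun w₂ h₂ => ?_
    rw [hc]
    refine mul_eval_le hc f fun w₁ h₁ => ?_
    rw [hc, ← wordEval_append f (ne_nil_of_mem_words h₁) (ne_nil_of_mem_words h₂)]
    exact h _ ⟨w₁, h₁, w₂, h₂, rfl⟩

theorem AiTerm.exists_letter_bound (t : AiTerm) : ∃ N, ∀ w ∈ t.words, ∀ x ∈ w, x < N := by
  induction t with
  | var n => exact ⟨n + 1, by simp [AiTerm.words]⟩
  | add u v hu hv =>
    obtain ⟨M, hM⟩ := hu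
    obtain ⟨N, hN⟩ := hv
    refine ⟨max M N, fun w hw x hx => lt_max_iff.2 ?_⟩
    exact hw.imp (fun h => hM w h x hx) fun h => hN w h x hx
  | mul u v hu hv =>
    obtain ⟨M, hM⟩ := hu
    obtain ⟨N, hN⟩ := hv
    refine ⟨max M N, ?_⟩
    rintro _ ⟨w₁, h₁, w₂, h₂, rfl⟩ x hx
    exact lt_max_iff.2 ((List.mem_append.1 hx).imp (hM w₁ h₁ x) (hN w₂ h₂ x))

end Words

/-! ### Inequalities of `S_(4,435)` between a word and a 2-colourable term -/

namespace S4435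

theorem mul_comm' : ∀ a b : S4435, a * b = b * a := by
  rintro (_ | _ | _ | _) (_ | _ | _ | _) <;> rfl

theorem e2_add (a : S4435) : e2 + a = a := by cases a <;> rfl

theorem e1_add (a : S4435) : e1 + a = e1 := by cases a <;> rfl

theorem e4_mul (a : S4435) : e4 * a = a := by cases a <;> rfl

theorem mul_ne_e2 : ∀ {a b : S4435}, a ≠ e2 → b ≠ e2 → a * b ≠ e2 := by
  rintro (_ | _ | _ | _) (_ | _ | _ | _) ha hb h <;>
    first | exact ha rfl | exact hb rfl | cases h

theorem e1_mul {a : S4435} (ha : a ≠ e2) : e1 * a = e1 := by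
  cases a <;> first | rfl | exact absurd rfl ha

theorem wordEval_eq_e2 {f : ℕ → S4435} {w : List ℕ} {x : ℕ} (hx : x ∈ w) (hf : f x = e2) :
    wordEval f w = e2 := by
  induction w with
  | nil => simp at hx
  | cons y l ih =>
    by_cases hl : l = []
    · subst hl
      obtain rfl : x = y := by simpa using hx
      exact hf
    · rw [wordEval_cons f y hl]
      rcases List.mem_cons.1 hx with rfl | hx
      · rw [hf]; rfl
      · rw [ih hx, mul_comm']; rfl

theorem wordEval_ne_e2 {f : ℕ → S4435} {w : List ℕ} (hw : w ≠ []) (hf : ∀ x ∈ w, f x ≠ e2) :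
    wordEval f w ≠ e2 := by
  induction w with
  | nil => exact absurd rfl hw
  | cons y l ih =>
    by_cases hl : l = []
    · subst hl
      exact hf y (by simp)
    · rw [wordEval_cons f y hl]
      exact mul_ne_e2 (hf y (by simp)) (ih hl fun x hx => hf x (by simp [hx]))

theorem wordEval_eq_e1 {f : ℕ → S4435} {w : List ℕ} {x : ℕ} (hx : x ∈ w) (hx1 : f x = e1)
    (hf : ∀ x ∈ w, f x ≠ e2) : wordEval f w = e1 := by
  induction w with
  | nil => simp at hx
  | cons y l ih =>
    by_cases hl : l = []
    · subst hl
      obtain rfl : x = y := by simpa using hx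
      exact hx1
    · have hf' : ∀ x ∈ l, f x ≠ e2 := fun x hx => hf x (by simp [hx])
      rw [wordEval_cons f y hl]
      rcases List.mem_cons.1 hx with rfl | hx
      · rw [hx1, e1_mul (wordEval_ne_e2 hl hf')]
      · rw [ih hx hf', mul_comm', e1_mul (hf y (by simp))]

theorem wordEval_eq_e4 {f : ℕ → S4435} {w : List ℕ} (hw : w ≠ []) (hf : ∀ x ∈ w, f x = e4) :
    wordEval f w = e4 := by
  induction w with
  | nil => exact absurd rfl hw
  | cons y l ih =>
    by_cases hl : l = []
    · subst hl
      exact hf y (by simp)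
    · rw [wordEval_cons f y hl, hf y (by simp), e4_mul, ih hl fun x hx => hf x (by simp [hx])]

variable {W : Set (List ℕ)} {w : List ℕ}

/-- If a word lies below a set of words in `S_(4,435)`, then each of its letters occurs in a word of
the set that uses only letters of the given word. -/
theorem exists_word_of_letter (hW : ∀ l ∈ W, l ≠ [])
    (H : ∀ (f : ℕ → S4435) (b : S4435), (∀ l ∈ W, wordEval f l + b = b) → wordEval f w + b = b)
    {x : ℕ} (hx : x ∈ w) : ∃ l ∈ W, x ∈ l ∧ ∀ y ∈ l, y ∈ w := by
  classical
  by_contra! hcon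
  let f : ℕ → S4435 := fun y => if y = x then e1 else if y ∈ w then e4 else e2
  have h := H f e4 fun l hl => by
    by_cases hlw : ∀ y ∈ l, y ∈ w
    · have hxl : x ∉ l := fun hxl => by
        obtain ⟨y, hy, hyw⟩ := hcon l hl hxl
        exact hyw (hlw y hy)
      rw [wordEval_eq_e4 (hW l hl)]
      · rfl
      · intro y hy
        have hyx : y ≠ x := fun h => hxl (h ▸ hy)
        simp [f, hyx, hlw y hy]
    · push Not at hlw
      obtain ⟨y, hy, hyw⟩ := hlw
      have hyx : y ≠ x := fun h => hyw (h ▸ hx)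
      rw [wordEval_eq_e2 hy (by simp [f, hyx, hyw]), e2_add]
  rw [wordEval_eq_e1 hx (by simp [f]), e1_add] at h
  · cases h
  · intro y hy
    by_cases hyx : y = x <;> simp [f, hyx, hy]

/-- Three letters, each of which takes the value `3` in at least one of two assignments, cannot occur
in one word whose value is at most `3` in both assignments. -/
theorem not_le_e3_of_three : ∀ {a b c a' b' c' r r' : S4435}, r ≠ e2 → r' ≠ e2 →
    (a = e3 ∧ a' = e3 ∨ a = e3 ∧ a' = e4 ∨ a = e4 ∧ a' = e3) →
    (b = e3 ∧ b' = e3 ∨ b = e3 ∧ b' = e4 ∨ b = e4 ∧ b' = e3) →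
    (c = e3 ∧ c' = e3 ∨ c = e3 ∧ c' = e4 ∨ c = e4 ∧ c' = e3) →
    a * (b * (c * r)) + e3 = e3 → a' * (b' * (c' * r')) + e3 = e3 → False := by
  intro a b c a' b' c' r r' hr hr' ha hb hc h h'
  rcases ha with ⟨rfl, rfl⟩ | ⟨rfl, rfl⟩ | ⟨rfl, rfl⟩ <;>
  rcases hb with ⟨rfl, rfl⟩ | ⟨rfl, rfl⟩ | ⟨rfl, rfl⟩ <;>
  rcases hc with ⟨rfl, rfl⟩ | ⟨rfl, rfl⟩ | ⟨rfl, rfl⟩ <;>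
  first
  | (cases r <;> first | exact hr rfl | exact absurd h (by decide))
  | (cases r' <;> first | exact hr' rfl | exact absurd h' (by decide))

/-- If a set consists of one-letter words and of two-letter words that are the edges of a
2-colourable graph on other letters, then a word below it in `S_(4,435)` belongs to it up to
commuting the letters. -/
theorem mem_words_of_le (hw : w ≠ []) (g : ℕ → Prop)
    (hW : ∀ l ∈ W, (∃ x, l = [x]) ∨ ∃ x y, l = [x, y] ∧ [x] ∉ W ∧ [y] ∉ W ∧ (g x ↔ ¬ g y))
    (H : ∀ (f : ℕ → S4435) (b : S4435), (∀ l ∈ W, wordEval f l + b = b) → wordEval f w + b = b) :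
    w ∈ W ∨ ∃ x y, w = [x, y] ∧ [y, x] ∈ W := by
  classical
  have hne : ∀ l ∈ W, l ≠ [] := by
    intro l hl
    rcases hW l hl with ⟨x, rfl⟩ | ⟨x, y, rfl, -⟩ <;> simp
  let F : (ℕ → Prop) → ℕ → S4435 := fun g x =>
    if x ∈ w then if [x] ∈ W then e3 else if g x then e3 else e4 else e2
  have hF : ∀ g' : ℕ → Prop, (∀ x y, (g x ↔ ¬ g y) → (g' x ↔ ¬ g' y)) →
      wordEval (F g') w + e3 = e3 := by
    intro g' hg'
    refine H _ _ fun l hl => ?_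
    by_cases hlw : ∀ y ∈ l, y ∈ w
    · rcases hW l hl with ⟨x, rfl⟩ | ⟨x, y, rfl, hx, hy, hxy⟩
      · have hxw : x ∈ w := hlw x (by simp)
        have hv : wordEval (F g') [x] = e3 := by simp [wordEval, F, hxw, hl]
        rw [hv]; rfl
      · have hxw : x ∈ w := hlw x (by simp)
        have hyw : y ∈ w := hlw y (by simp)
        have hv : wordEval (F g') [x, y] = e3 := by
          have := hg' x y hxy
          by_cases hgy : g' y <;> simp [wordEval, F, hxw, hyw, hx, hy, hgy, this] <;> rfl
        rw [hv]; rfl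
    · push Not at hlw
      obtain ⟨y, hy, hyw⟩ := hlw
      rw [wordEval_eq_e2 hy (by simp [F, hyw]), e2_add]
  have h₁ := hF g fun _ _ h => h
  have h₂ := hF (fun x => ¬ g x) fun x y h => not_congr h
  set f₁ := F g
  set f₂ := F fun x => ¬ g x
  have hval : ∀ x ∈ w, f₁ x = e3 ∧ f₂ x = e3 ∨ f₁ x = e3 ∧ f₂ x = e4 ∨ f₁ x = e4 ∧ f₂ x = e3 := by
    intro x hx
    by_cases hxW : [x] ∈ W <;> by_cases hgx : g x <;> simp [f₁, f₂, F, hx, hxW, hgx]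
  have hne₁ : ∀ x ∈ w, f₁ x ≠ e2 := fun x hx h => by
    rcases hval x hx with h' | h' | h' <;> rw [h'.1] at h <;> cases h
  have hne₂ : ∀ x ∈ w, f₂ x ≠ e2 := fun x hx h => by
    rcases hval x hx with h' | h' | h' <;> rw [h'.2] at h <;> cases h
  have hsingle : ∀ x ∈ w, [x] ∈ W → f₁ x = e3 ∧ f₂ x = e3 := fun x hx hxW => by
    simp [f₁, f₂, F, hx, hxW]
  have key : ∀ x ∈ w, ∃ l ∈ W, x ∈ l ∧ ∀ y ∈ l, y ∈ w := fun x hx =>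
    exists_word_of_letter hne H hx
  match w, hw with
  | [x], _ =>
    obtain ⟨l, hl, -, hlw⟩ := key x (by simp)
    rcases hW l hl with ⟨y, rfl⟩ | ⟨y, z, rfl, -, -, hyz⟩
    · obtain rfl : y = x := by simpa using hlw y (by simp)
      exact Or.inl hl
    · obtain rfl : y = x := by simpa using hlw y (by simp)
      obtain rfl : z = y := by simpa using hlw z (by simp)
      tauto
  | [x, y], _ =>
    change f₁ x * f₁ y + e3 = e3 at h₁
    change f₂ x * f₂ y + e3 = e3 at h₂
    have hnot : ∀ z ∈ [x, y], [z] ∉ W := by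
      intro z hz hzW
      obtain ⟨hz₁, hz₂⟩ := hsingle z hz hzW
      rcases hval x (by simp) with ⟨a, b⟩ | ⟨a, b⟩ | ⟨a, b⟩ <;>
      rcases hval y (by simp) with ⟨c, d⟩ | ⟨c, d⟩ | ⟨c, d⟩ <;>
      rw [a, c] at h₁ <;> rw [b, d] at h₂ <;>
      first
      | exact absurd h₁ (by decide)
      | exact absurd h₂ (by decide)
      | (rcases List.mem_pair.1 hz with rfl | rfl <;> simp_all)
    obtain ⟨l, hl, hxl, hlw⟩ := key x (by simp)
    rcases hW l hl with ⟨z, rfl⟩ | ⟨z, z', rfl, -, -, hzz⟩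
    · exact absurd hl (hnot z (hlw z (by simp)))
    · have hz := List.mem_pair.1 (hlw z (by simp))
      have hz' := List.mem_pair.1 (hlw z' (by simp))
      rcases hz with rfl | rfl <;> rcases hz' with rfl | rfl
      · tauto
      · exact Or.inl hl
      · exact Or.inr ⟨_, _, rfl, hl⟩
      · tauto
  | x :: y :: z :: l, _ =>
    exfalso
    -- The tail after three letters may be empty; the unit `4` then serves as its value.
    have hsplit : ∀ f : ℕ → S4435, (∀ v ∈ x :: y :: z :: l, f v ≠ e2) → ∃ r : S4435, r ≠ e2 ∧
        wordEval f (x :: y :: z :: l) = f x * (f y * (f z * r)) := by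
      intro f hf
      by_cases hl : l = []
      · subst hl
        exact ⟨e4, by simp, by rw [mul_comm' (f z) e4, e4_mul]; rfl⟩
      · refine ⟨wordEval f l, wordEval_ne_e2 hl fun v hv => hf v (by simp [hv]), ?_⟩
        rw [← wordEval_cons f z hl]; rfl
    obtain ⟨r₁, hr₁, he₁⟩ := hsplit f₁ hne₁
    obtain ⟨r₂, hr₂, he₂⟩ := hsplit f₂ hne₂
    rw [he₁] at h₁
    rw [he₂] at h₂
    exact not_le_e3_of_three hr₁ hr₂ (hval x (by simp)) (hval y (by simp)) (hval z (by simp)) h₁ h₂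

end S4435

/-! ### The semiring of vertex sets of a cycle -/

/-- Adjacency in the cycle with vertex set `ZMod n`. -/
def CycleAdj {n : ℕ} (p q : ZMod n) : Prop := q = p + 1 ∨ p = q + 1

/-- The carrier of an ai-semiring attached to the `n`-cycle: nonempty sets of vertices, one element
`edge` standing for all nonempty sets of edges, and an absorbing element `top`. -/
inductive CycleModel (n : ℕ) : Type where
  | top
  | edge
  | vert (P : Set (ZMod n)) (hP : P.Nonempty)

namespace CycleModel

variable {n : ℕ}

/-- Sets of vertices are added by taking unions; sums of elements of different kinds are `top`. -/
def add : CycleModel n → CycleModel n → CycleModel n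
  | edge, edge => edge
  | vert P hP, vert Q _ => vert (P ∪ Q) hP.inl
  | _, _ => top

open Classical in
/-- The product of two sets of vertices is `edge` if they are completely joined in the cycle; all
other products are `top`. -/
noncomputable def mul : CycleModel n → CycleModel n → CycleModel n
  | vert P _, vert Q _ => if ∀ p ∈ P, ∀ q ∈ Q, CycleAdj p q then edge else top
  | _, _ => top

theorem mul_eq_edge_or_top (a b : CycleModel n) : mul a b = edge ∨ mul a b = top := by
  rcases a with _ | _ | _ <;> rcases b with _ | _ | _ <;>
    try exact Or.inr rfl
  simp only [mul]
  split_ifs <;> simp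

theorem mul_comm_aux (a b : CycleModel n) : mul a b = mul b a := by
  rcases a with _ | _ | ⟨P, hP⟩ <;> rcases b with _ | _ | ⟨Q, hQ⟩ <;> try rfl
  have : (∀ p ∈ P, ∀ q ∈ Q, CycleAdj p q) ↔ ∀ q ∈ Q, ∀ p ∈ P, CycleAdj q p :=
    ⟨fun h q hq p hp => (h p hp q hq).symm, fun h p hp q hq => (h q hq p hp).symm⟩
  classical
  simp only [mul]
  exact if_congr this rfl rfl

theorem mul_mul_eq_top (a b c : CycleModel n) : mul a (mul b c) = top := by
  rcases mul_eq_edge_or_top b c with h | h <;> rw [h] <;> cases a <;> rfl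

theorem mul_add_aux (a b c : CycleModel n) : mul a (add b c) = add (mul a b) (mul a c) := by
  rcases a with _ | _ | ⟨P, hP⟩ <;> rcases b with _ | _ | ⟨Q, hQ⟩ <;>
    rcases c with _ | _ | ⟨R, hR⟩ <;> try rfl
  · simp only [add, mul]; split_ifs <;> rfl
  · simp only [add, mul]; split_ifs <;> rfl
  · have : (∀ p ∈ P, ∀ q ∈ Q ∪ R, CycleAdj p q) ↔
        (∀ p ∈ P, ∀ q ∈ Q, CycleAdj p q) ∧ ∀ p ∈ P, ∀ q ∈ R, CycleAdj p q :=
      ⟨fun h => ⟨fun p hp q hq => h p hp q (Or.inl hq), fun p hp q hq => h p hp q (Or.inr hq)⟩,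
        fun h p hp q hq => hq.elim (h.1 p hp q) (h.2 p hp q)⟩
    simp only [add, mul]
    split_ifs with h <;>
    first
    | rfl
    | exact absurd (this.1 h).1 (by assumption)
    | exact absurd (this.1 h).2 (by assumption)
    | exact absurd (this.2 ⟨by assumption, by assumption⟩) h

noncomputable instance : AiSemiring (CycleModel n) where
  add := add
  mul := mul
  add_assoc := by
    rintro (_ | _ | ⟨P, hP⟩) (_ | _ | ⟨Q, hQ⟩) (_ | _ | ⟨R, hR⟩) <;> try rfl
    change vert _ _ = vert _ _
    simp only [Set.union_assoc]
  add_comm := by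
    rintro (_ | _ | ⟨P, hP⟩) (_ | _ | ⟨Q, hQ⟩) <;> try rfl
    change vert _ _ = vert _ _
    simp only [Set.union_comm]
  mul_assoc := by
    intro a b c
    change mul (mul a b) c = mul a (mul b c)
    rw [mul_comm_aux, mul_mul_eq_top, mul_mul_eq_top]
  left_distrib := mul_add_aux
  right_distrib := by
    intro a b c
    change mul (add a b) c = add (mul a c) (mul b c)
    rw [mul_comm_aux, mul_add_aux, mul_comm_aux c a, mul_comm_aux c b]
  add_idem := by
    rintro (_ | _ | ⟨P, hP⟩) <;> try rfl
    change vert _ _ = vert _ _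
    simp only [Set.union_self]

theorem mul_comm' (a b : CycleModel n) : a * b = b * a := mul_comm_aux a b

theorem mul_mul_eq_top' (a b c : CycleModel n) : a * (b * c) = top := mul_mul_eq_top a b c

theorem add_top (a : CycleModel n) : a + top = top := by cases a <;> rfl

theorem top_add (a : CycleModel n) : top + a = top := by cases a <;> rfl

theorem eq_edge_of_le_edge {a : CycleModel n} (h : a + edge = edge) : a = edge := by
  cases a with
  | edge => rfl
  | top => cases h
  | vert P hP => cases h

theorem eq_edge_of_edge_le {a : CycleModel n} (h : edge + a = a) (ha : a ≠ top) : a = edge := by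
  cases a with
  | edge => rfl
  | top => exact absurd rfl ha
  | vert P hP => cases h

theorem exists_of_mul_ne_top {a b : CycleModel n} (h : a * b ≠ top) :
    ∃ P hP Q hQ, a = vert P hP ∧ b = vert Q hQ ∧ (∀ p ∈ P, ∀ q ∈ Q, CycleAdj p q) ∧
      a * b = edge := by
  rcases a with _ | _ | ⟨P, hP⟩ <;> rcases b with _ | _ | ⟨Q, hQ⟩ <;> try exact absurd rfl h
  refine ⟨P, hP, Q, hQ, rfl, rfl, ?_, (mul_eq_edge_or_top _ _).resolve_right h⟩
  by_contra hPQ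
  exact h (if_neg hPQ)

/-- A vertex of an element of the model; the value at `edge` and `top` is junk. -/
noncomputable def vertex : CycleModel n → ZMod n
  | vert _ hP => hP.some
  | _ => 0

/-- The parity of the distance from a fixed vertex, measured in one direction, is a 2-colouring of
the cycle without that vertex. -/
theorem even_val_sub_iff [NeZero n] {p q v : ZMod n} (hp : p ≠ v) (hq : q ≠ v)
    (h : CycleAdj p q) : Even (p - v).val ↔ ¬ Even (q - v).val := by
  have main : ∀ c : ZMod n, c + 1 ≠ 0 → (c + 1).val = c.val + 1 := by
    intro c hc
    have hlt := ZMod.val_lt c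
    have hne : c.val + 1 ≠ n := fun h => hc <| by
      rw [← ZMod.natCast_zmod_val c, ← Nat.cast_one, ← Nat.cast_add, h, ZMod.natCast_self]
    have hlt' : c.val + 1 < n := by omega
    conv_lhs => rw [← ZMod.natCast_zmod_val c, ← Nat.cast_one, ← Nat.cast_add]
    exact ZMod.val_cast_of_lt hlt'
  rcases h with rfl | rfl
  · have h := main (p - v) (by rw [sub_add_eq_add_sub]; exact sub_ne_zero.2 hq)
    rw [sub_add_eq_add_sub] at h
    rw [h, Nat.even_add_one, not_not]
  · have h := main (q - v) (by rw [sub_add_eq_add_sub]; exact sub_ne_zero.2 hp)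
    rw [sub_add_eq_add_sub] at h
    rw [h, Nat.even_add_one]

/-- A term in fewer than `n` letters whose value is not `top` is a sum of one-letter words and of the
edges of a 2-colourable graph on other letters. -/
theorem exists_colouring {N : ℕ} (hN : N < n) (f : ℕ → CycleModel n) {u : AiTerm}
    (hu : ∀ l ∈ u.words, ∀ x ∈ l, x < N) (htop : u.eval f ≠ top) :
    ∃ g : ℕ → Prop, ∀ l ∈ u.words, (∃ x, l = [x]) ∨
      ∃ x y, l = [x, y] ∧ [x] ∉ u.words ∧ [y] ∉ u.words ∧ (g x ↔ ¬ g y) := by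
  classical
  have : NeZero n := ⟨by omega⟩
  obtain ⟨v, hv⟩ : ∃ v : ZMod n, v ∉ (Finset.range N).image fun x => (f x).vertex := by
    by_contra! h
    have h₁ := Finset.card_le_card fun v (_ : v ∈ Finset.univ) => h v
    have h₂ := h₁.trans Finset.card_image_le
    rw [Finset.card_univ, ZMod.card, Finset.card_range] at h₂
    omega
  have hv' : ∀ x < N, (f x).vertex ≠ v := fun x hx h =>
    hv (Finset.mem_image.2 ⟨x, Finset.mem_range.2 hx, h⟩)
  refine ⟨fun x => Even ((f x).vertex - v).val, fun l hl => ?_⟩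
  have hle := AiTerm.word_le_eval f hl
  match l, AiTerm.ne_nil_of_mem_words hl with
  | [x], _ => exact Or.inl ⟨x, rfl⟩
  | [x, y], _ =>
    change f x * f y + _ = _ at hle
    obtain ⟨P, hP, Q, hQ, hx, hy, hPQ, hxy⟩ := exists_of_mul_ne_top (a := f x) (b := f y)
      fun h => htop (by rw [← hle, h, top_add])
    rw [hxy] at hle
    have hedge := eq_edge_of_edge_le hle htop
    have hnot : ∀ {z : ℕ} {R hR}, f z = vert R hR → [z] ∉ u.words := by
      intro z R hR hz hzu
      have h := AiTerm.word_le_eval f hzu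
      rw [hedge] at h
      have h' : f z = edge := eq_edge_of_le_edge h
      rw [hz] at h'
      cases h'
    refine Or.inr ⟨x, y, rfl, hnot hx, hnot hy, even_val_sub_iff (hv' x (hu _ hl x (by simp)))
      (hv' y (hu _ hl y (by simp))) ?_⟩
    rw [hx, hy]
    exact hPQ _ hP.some_mem _ hQ.some_mem
  | x :: y :: z :: l, _ =>
    refine absurd ?_ htop
    change f x * (f y * wordEval f (z :: l)) + _ = _ at hle
    rw [← hle, mul_mul_eq_top', top_add]

theorem eval_le_of_holdsIn {N : ℕ} (hN : N < n) {u v : AiTerm}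
    (hu : ∀ l ∈ u.words, ∀ x ∈ l, x < N) (h : AiIdentity.HoldsIn (u, v) S4435)
    (f : ℕ → CycleModel n) : v.eval f + u.eval f = u.eval f := by
  by_cases htop : u.eval f = top
  · rw [htop, add_top]
  obtain ⟨g, hg⟩ := exists_colouring hN f hu htop
  refine AiTerm.eval_le mul_comm' f fun w hw => ?_
  have H : ∀ (φ : ℕ → S4435) (b : S4435),
      (∀ l ∈ u.words, wordEval φ l + b = b) → wordEval φ w + b = b := by
    intro φ b hb
    have huv : u.eval φ = v.eval φ := h φ
    refine AiSemiring.le_trans (AiTerm.word_le_eval φ hw) ?_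
    rw [← huv]
    exact AiTerm.eval_le S4435.mul_comm' φ hb
  rcases S4435.mem_words_of_le (AiTerm.ne_nil_of_mem_words hw) g hg H with hwu | ⟨x, y, rfl, hyx⟩
  · exact AiTerm.word_le_eval f hwu
  · have hcomm : wordEval f [x, y] = wordEval f [y, x] := mul_comm' (f x) (f y)
    rw [hcomm]
    exact AiTerm.word_le_eval f hyx

theorem holdsIn {N : ℕ} (hN : N < n) {e : AiIdentity}
    (h₁ : ∀ l ∈ e.1.words, ∀ x ∈ l, x < N) (h₂ : ∀ l ∈ e.2.words, ∀ x ∈ l, x < N)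
    (h : e.HoldsIn S4435) : e.HoldsIn (CycleModel n) := by
  intro f
  have hle := eval_le_of_holdsIn hN h₁ h f
  have hge := eval_le_of_holdsIn hN (v := e.1) h₂ (fun φ => (h φ).symm) f
  rw [← hle, add_comm, hge]

end CycleModel

/-! ### The identity of an odd cycle -/

/-- The sum of the edges `xᵢ xᵢ₊₁`, `i ≤ m`, of a path. -/
def pathTerm : ℕ → AiTerm
  | 0 => .mul (.var 0) (.var 1)
  | m + 1 => .add (pathTerm m) (.mul (.var (m + 1)) (.var (m + 2)))

/-- The product of the letters `x₀, …, xₘ`. -/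
def prodTerm : ℕ → AiTerm
  | 0 => .var 0
  | m + 1 => .mul (prodTerm m) (.var (m + 1))

/-- The sum of the edges of the cycle on `x₀, …, xₘ₊₁`. -/
def cycleTerm (m : ℕ) : AiTerm := .add (pathTerm m) (.mul (.var (m + 1)) (.var 0))

/-- The identity saying that the sum of the edges of the cycle on `x₀, …, xₘ₊₁` dominates the
product of all these letters. -/
def cycleIdentity (m : ℕ) : AiIdentity := (cycleTerm m, .add (cycleTerm m) (prodTerm (m + 1)))

namespace S4435

theorem eval_prodTerm_eq_e2 {f : ℕ → S4435} {m i : ℕ} (hi : i ≤ m) (hf : f i = e2) :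
    (prodTerm m).eval f = e2 := by
  induction m with
  | zero =>
    obtain rfl : i = 0 := by omega
    exact hf
  | succ m ih =>
    change (prodTerm m).eval f * f (m + 1) = e2
    rcases Nat.lt_or_ge m i with h | h
    · obtain rfl : i = m + 1 := by omega
      rw [hf, mul_comm']; rfl
    · rw [ih h]; rfl

theorem eval_prodTerm_eq_e4 {f : ℕ → S4435} {m : ℕ} (hf : ∀ i ≤ m, f i = e4) :
    (prodTerm m).eval f = e4 := by
  induction m with
  | zero => exact hf 0 le_rfl
  | succ m ih =>
    change (prodTerm m).eval f * f (m + 1) = e4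
    rw [ih fun i hi => hf i (by omega), hf (m + 1) le_rfl]; rfl

/-- Unless the sum of the edges of a path has the value `1`, the letters are all `4`, or they are
alternately `3` and `4`. -/
theorem eval_pathTerm {f : ℕ → S4435} {m : ℕ} (hf : ∀ i ≤ m + 1, f i ≠ e2) :
    (pathTerm m).eval f = e1 ∨
    ((pathTerm m).eval f = e4 ∧ ∀ i ≤ m + 1, f i = e4) ∨
    ((pathTerm m).eval f = e3 ∧ (f 0 = e3 ∧ f (m + 1) = (if Even m then e4 else e3) ∨
      f 0 = e4 ∧ f (m + 1) = (if Even m then e3 else e4))) := by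
  induction m with
  | zero =>
    have h₀ := hf 0 (by omega)
    have h₁ := hf 1 (by omega)
    change f 0 * f 1 = e1 ∨ (f 0 * f 1 = e4 ∧ _) ∨ (f 0 * f 1 = e3 ∧ _)
    rcases h : f 0 with _ | _ | _ | _ <;> rcases h' : f 1 with _ | _ | _ | _ <;>
      first
      | exact absurd h h₀
      | exact absurd h' h₁
      | exact Or.inl rfl
      | exact Or.inr (Or.inr ⟨rfl, by simp⟩)
      | (refine Or.inr (Or.inl ⟨rfl, fun i hi => ?_⟩)
         interval_cases i <;> assumption)
  | succ m ih =>
    have h₂ := hf (m + 2) (by omega)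
    change (pathTerm m).eval f + f (m + 1) * f (m + 2) = e1 ∨
      ((pathTerm m).eval f + f (m + 1) * f (m + 2) = e4 ∧ _) ∨
      ((pathTerm m).eval f + f (m + 1) * f (m + 2) = e3 ∧ _)
    rcases ih fun i hi => hf i (by omega) with h | ⟨h, h'⟩ | ⟨h, h'⟩
    · rw [h, e1_add]
      exact Or.inl rfl
    · rw [h, h' (m + 1) le_rfl, e4_mul]
      rcases h'' : f (m + 2) with _ | _ | _ | _
      · exact Or.inl rfl
      · exact absurd h'' h₂
      · exact Or.inl rfl
      · refine Or.inr (Or.inl ⟨rfl, fun i hi => ?_⟩)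
        rcases Nat.lt_or_ge i (m + 2) with hlt | hge
        · exact h' i (by omega)
        · obtain rfl : i = m + 2 := by omega
          exact h''
    · rw [h]
      by_cases hm : Even m <;> simp only [hm, if_true, if_false, Nat.even_add_one, not_true,
        not_false_iff] at h' ⊢ <;>
      rcases h' with ⟨h₀, h₁⟩ | ⟨h₀, h₁⟩ <;> rw [h₀, h₁] <;>
      rcases h'' : f (m + 2) with _ | _ | _ | _ <;>
      first
      | exact absurd h'' h₂
      | exact Or.inl rfl
      | exact Or.inr (Or.inr ⟨rfl, by simp⟩)

end S4435

open S4435 in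
theorem cycleIdentity_holdsIn {m : ℕ} (hm : ¬ Even m) : (cycleIdentity m).HoldsIn S4435 := by
  intro f
  suffices h : (prodTerm (m + 1)).eval f + (cycleTerm m).eval f = (cycleTerm m).eval f by
    change (cycleTerm m).eval f = (cycleTerm m).eval f + (prodTerm (m + 1)).eval f
    rw [add_comm, h]
  by_cases hf : ∀ i ≤ m + 1, f i ≠ e2
  · change _ + ((pathTerm m).eval f + f (m + 1) * f 0) = (pathTerm m).eval f + f (m + 1) * f 0
    rcases eval_pathTerm hf with h | ⟨h, h'⟩ | ⟨h, h' | h'⟩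
    · rw [h, e1_add, add_comm, e1_add]
    · rw [h, eval_prodTerm_eq_e4 h', h' 0 (by omega), h' (m + 1) le_rfl]; rfl
    -- An alternating colouring gives both ends of the last edge the same colour.
    · rw [h, h'.1, h'.2, if_neg hm, show e3 + e3 * e3 = e1 from rfl, add_comm, e1_add]
    · rw [h, h'.1, h'.2, if_neg hm, show e3 + e4 * e4 = e1 from rfl, add_comm, e1_add]
  · push Not at hf
    obtain ⟨i, hi, hfi⟩ := hf
    rw [eval_prodTerm_eq_e2 hi hfi, e2_add]

namespace CycleModel

theorem vert_mul_vert_of_adj {n : ℕ} {p q : ZMod n} (h : CycleAdj p q) :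
    vert {p} (Set.singleton_nonempty p) * vert {q} (Set.singleton_nonempty q) = edge := by
  refine if_pos ?_
  rintro _ rfl _ rfl
  exact h

theorem not_cycleIdentity_holdsIn {m : ℕ} (hm : m ≠ 0) :
    ¬ (cycleIdentity m).HoldsIn (CycleModel (m + 2)) := by
  intro h
  let f : ℕ → CycleModel (m + 2) := fun i => vert {(i : ZMod (m + 2))} (Set.singleton_nonempty _)
  have hsucc : ∀ i, f i * f (i + 1) = edge := fun i =>
    vert_mul_vert_of_adj (Or.inl (by push_cast; rfl))
  have hpath : ∀ k, (pathTerm k).eval f = edge := by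
    intro k
    induction k with
    | zero => exact hsucc 0
    | succ k ih =>
      change (pathTerm k).eval f + f (k + 1) * f (k + 2) = edge
      rw [ih, hsucc (k + 1)]; rfl
  have hlast : f (m + 1) * f 0 = edge := by
    refine vert_mul_vert_of_adj (Or.inl ?_)
    have := ZMod.natCast_self (m + 2)
    push_cast at this ⊢
    rw [add_assoc, one_add_one_eq_two, this]
  have hcycle : (cycleTerm m).eval f = edge := by
    change (pathTerm m).eval f + f (m + 1) * f 0 = edge
    rw [hpath, hlast]; rfl
  have hprod : (prodTerm (m + 1)).eval f = top := by
    obtain ⟨k, rfl⟩ := Nat.exists_eq_succ_of_ne_zero hm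
    change (prodTerm k).eval f * f (k + 1) * f (k + 1 + 1) = top
    rw [mul_assoc, mul_mul_eq_top']
  have h' : (cycleTerm m).eval f = (cycleTerm m).eval f + (prodTerm (m + 1)).eval f := h f
  rw [hcycle, hprod, add_top] at h'
  cases h'

end CycleModel

/-! ### The isomorphism and the absence of a finite basis -/

theorem exists_letter_bound_of_finite {B : Set AiIdentity} (hB : B.Finite) :
    ∃ N, ∀ e ∈ B, (∀ l ∈ e.1.words, ∀ x ∈ l, x < N) ∧ ∀ l ∈ e.2.words, ∀ x ∈ l, x < N := by
  choose b hb using AiTerm.exists_letter_bound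
  obtain ⟨N, hN⟩ := (hB.image fun e => max (b e.1) (b e.2)).bddAbove
  refine ⟨N, fun e he => ?_⟩
  have h : max (b e.1) (b e.2) ≤ N := hN ⟨e, he, rfl⟩
  exact ⟨fun l hl x hx => (hb _ l hl x hx).trans_le ((le_max_left _ _).trans h),
    fun l hl x hx => (hb _ l hl x hx).trans_le ((le_max_right _ _).trans h)⟩

theorem S4435.not_isFinitelyBased : ¬ IsFinitelyBased S4435 := by
  rintro ⟨B, hB, hsound, hcomplete⟩
  obtain ⟨N, hN⟩ := exists_letter_bound_of_finite hB
  -- The cycle has the odd length `2 * N + 3`, which exceeds the number of letters in `B`.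
  refine CycleModel.not_cycleIdentity_holdsIn (m := 2 * N + 1) (by omega)
    (hcomplete _ (cycleIdentity_holdsIn (by simp)) _ fun e he => ?_)
  exact CycleModel.holdsIn (by omega) (hN e he).1 (hN e he).2 (hsound e he)

/-- The isomorphism `1 ↦ ∞`, `2 ↦ 0`, `3 ↦ a`, `4 ↦ 1`. -/
def S4435.equivWithZeroS7 : S4435 ≃+* WithZero S7 where
  toFun
    | e1 => some S7.infty
    | e2 => none
    | e3 => some S7.a
    | e4 => some S7.one
  invFun
    | none => e2
    | some S7.infty => e1
    | some S7.a => e3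
    | some S7.one => e4
  left_inv := by rintro (_ | _ | _ | _) <;> rfl
  right_inv := by rintro (_ | _ | _ | _) <;> rfl
  map_mul' := by rintro (_ | _ | _ | _) (_ | _ | _ | _) <;> rfl
  map_add' := by rintro (_ | _ | _ | _) (_ | _ | _ | _) <;> rfl

theorem mainTheorem2 :
    Nonempty (S4435 ≃+* WithZero S7) ∧ ¬ IsFinitelyBased S4435 :=
  ⟨⟨S4435.equivWithZeroS7⟩, S4435.not_isFinitelyBased⟩
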